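/- For $F:\{0,1\}^m\to\{0,1\}$ and $k\ge 1$, let $F_k:\{0,1\}^m\to\mathbb{Z}/2^k\mathbb{Z}$ be the $k$-lift of $F$: $F_k(x)=0$ if $F(x)=0$ and $F_k(x)=2^{k-1}$ if $F(x)=1$. Let $$\gamma_{d,k}(F)=\max_{Q}\ \Pr_{x\sim\{0,1\}^m}\bigl[F_k(x)=Q(x)\bigr],$$ where $x$ is uniform and $Q$ ranges over the multilinear polynomials in $\mathbb{Z}/2^k\mathbb{Z}[x_1,\dots,x_m]$ of degree at most $d$. **Theorem.** Let $d\in\mathbb{N}$ be a power of $2$ (including $d=1$). There is a sequence $\varepsilon_n\to 0$ of real numbers (depending only on $d$) such that for all large enough $n$ there exists a function $F:\{0,1\}^{2n}\to\{0,1\}$ with $$\gamma_{2d,2}(F)\ \ge\ \tfrac34-\varepsilon_n,\qquad \gamma_{3d-1,1}(F)\ \le\ \tfrac58+\varepsilon_n,$$ and $\gamma_{3d-1,1}(F)<\gamma_{2d,2}(F)$. In particular ($d=1$), for all large enough $n$ there is $F:\{0,1\}^{2n}\to\{0,1\}$ with $\gamma_{2,2}(F)>\gamma_{2,1}(F)$.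 -/

import Mathlib

open Filter Topology

namespace BoolApprox

/-- The `k`-lift of a Boolean function: the value `0` stays `0`, the value `1` becomes `2^(k-1)` in
`ℤ/2^kℤ`. -/
def lift {ι : Type*} (k : ℕ) (F : (ι → Bool) → Bool) : (ι → Bool) → ZMod (2 ^ k) :=
  fun x => if F x then 2 ^ (k - 1) else 0

/-- The multilinear polynomials of degree at most `d` over `ℤ/2^kℤ`. -/
def multilinearPolys (ι : Type*) (d k : ℕ) : Set (MvPolynomial ι (ZMod (2 ^ k))) :=
  {Q | (∀ i, Q.degreeOf i ≤ 1) ∧ Q.totalDegree ≤ d}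

/-- The function on `{0,1}^ι` computed by a polynomial. -/
noncomputable def polyFun {ι R : Type*} [CommSemiring R] (Q : MvPolynomial ι R) :
    (ι → Bool) → R :=
  fun x => MvPolynomial.eval (fun i => if x i then 1 else 0) Q

/-- The agreement of two functions on a finite domain: the fraction of inputs where they agree. -/
noncomputable def agr {D R : Type*} [Fintype D] [DecidableEq R] (f g : D → R) : ℝ :=
  ((Finset.univ.filter fun x => f x = g x).card : ℝ) / (Fintype.card D : ℝ)

/-- `gamma d k F` is the largest agreement of the `k`-lift of `F` with a multilinear polynomial of
degree at most `d` over `ℤ/2^kℤ` (the supremum is attained, see `isGreatest_gamma`). -/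
noncomputable def gamma {ι : Type*} [Fintype ι] [DecidableEq ι] (d k : ℕ)
    (F : (ι → Bool) → Bool) : ℝ :=
  sSup ((fun Q => agr (lift k F) (polyFun Q)) '' multilinearPolys ι d k)

theorem isGreatest_gamma {ι : Type*} [Fintype ι] [DecidableEq ι] (d k : ℕ)
    (F : (ι → Bool) → Bool) :
    IsGreatest ((fun Q => agr (lift k F) (polyFun Q)) '' multilinearPolys ι d k)
      (gamma d k F) := by
  have hne : ((fun Q => agr (lift k F) (polyFun Q)) '' multilinearPolys ι d k).Nonempty :=
    ⟨_, 0, by simp [multilinearPolys], rfl⟩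
  have hfin : ((fun Q => agr (lift k F) (polyFun Q)) '' multilinearPolys ι d k).Finite := by
    refine (Set.finite_range fun s : Finset (ι → Bool) =>
      (s.card : ℝ) / (Fintype.card (ι → Bool) : ℝ)).subset ?_
    rintro _ ⟨Q, -, rfl⟩
    exact ⟨_, rfl⟩
  exact ⟨hne.csSup_mem hfin, fun _ h => le_csSup hfin.bddAbove h⟩

end BoolApprox

/-!
Write `d = 2 ^ l`, let `e_j` be the elementary symmetric polynomials and let `F` be the function on
two blocks of `n` variables computed modulo `2` by `e_d(x) e_{2d}(y) + e_{2d}(x) e_d(y)`. At a point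
with `x` ones in a block, `e_j` takes the value `C(x, j)`.

Modulo `4`: if `C(x, d)` is even, then `C(x, d) = 2 C(x, 2d)`, because `C(2d, d) = 2`. Hence the
polynomial `e_d(x) e_d(y)` of degree `2d` agrees with the lift of `F` unless `C(x, d)` and `C(y, d)`
are both odd, that is, unless the binary digit of weight `d` is `1` in both block weights. This has
probability tending to `1/4`.

Modulo `2`: adding to `F` a competitor of degree less than `3d` leaves the part of degree `3d`
unchanged, and the question is how often the sum vanishes. By Ramsey's theorem the sum may be
assumed symmetric in each block. By Lucas' theorem, once the lower digits of the block weights are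
fixed, it is then a polynomial of degree `3` in the binary digits of weight `d` and `2d`, with the
leading form of the case `d = 1`; such a polynomial has at most `10` zeros among the `16` points.
The block weights equidistribute modulo `4d`, which gives the bound `10/16 = 5/8` in the limit.
-/

namespace BoolApprox

open Finset
open scoped BigOperators

universe u v w

/-! ### Ramsey's theorem for two blocks -/

/-- `N` is a Ramsey bound: any colouring with at most `q` colours of the subsets of a set with at
least `N` elements is constant on the `k`-subsets of some `m`-element subset. -/
def IsRamseyBound (k q m N : ℕ) : Prop :=
  ∀ {α : Type u} {κ : Type v} [Finite κ], Nat.card κ ≤ q →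
    ∀ (A : Finset α) (c : Finset α → κ), N ≤ #A →
      ∃ H ⊆ A, #H = m ∧ ∃ g, ∀ S ⊆ H, #S = k → c S = g

theorem exists_subset_color_eq_of_mem {k q : ℕ}
    (h : ∀ m, ∃ N, IsRamseyBound.{u, v} k q m N) (t : ℕ) :
    ∃ N, ∀ {α : Type u} {κ : Type v} [Finite κ], Nat.card κ ≤ q →
      ∀ (A : Finset α) (c : Finset α → κ), N ≤ #A →
        ∃ H ⊆ A, #H = t ∧ ∃ f : α → κ, ∀ S ⊆ H, #S = k + 1 → ∃ a ∈ S, c S = f a := by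
  classical
  induction t with
  | zero =>
    refine ⟨0, fun _ A c _ => ⟨∅, empty_subset A, card_empty, fun _ => c ∅, fun S hS hk => ?_⟩⟩
    simp [subset_empty.1 hS] at hk
  | succ t ih =>
    obtain ⟨N₁, hN₁⟩ := ih
    obtain ⟨N₂, hN₂⟩ := h N₁
    refine ⟨N₂ + 1, fun hκ A c hA => ?_⟩
    obtain ⟨a₀, ha₀⟩ : A.Nonempty := card_pos.1 (by lia)
    obtain ⟨H₁, hH₁A, hH₁, g, hg⟩ := hN₂ hκ (A.erase a₀) (fun S => c (insert a₀ S))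
      (by rw [card_erase_of_mem ha₀]; lia)
    obtain ⟨H₂, hH₂H₁, hH₂, f, hf⟩ := hN₁ hκ H₁ c hH₁.ge
    have ha₀H₂ : a₀ ∉ H₂ := fun ha => notMem_erase a₀ A (hH₁A (hH₂H₁ ha))
    refine ⟨insert a₀ H₂, insert_subset ha₀ ((hH₂H₁.trans hH₁A).trans (erase_subset _ _)),
      by rw [card_insert_of_notMem ha₀H₂, hH₂], Function.update f a₀ g, fun S hS hk => ?_⟩
    by_cases haS : a₀ ∈ S
    · refine ⟨a₀, haS, ?_⟩
      have hSH₁ : S.erase a₀ ⊆ H₁ := (subset_insert_iff.1 hS).trans hH₂H₁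
      have := hg (S.erase a₀) hSH₁ (by rw [card_erase_of_mem haS, hk, Nat.add_sub_cancel])
      rwa [insert_erase haS, ← Function.update_self a₀ g f] at this
    · have hSH₂ : S ⊆ H₂ := (subset_insert_iff_of_notMem haS).1 hS
      obtain ⟨a, ha, hca⟩ := hf S hSH₂ hk
      refine ⟨a, ha, ?_⟩
      rw [hca, Function.update_of_ne (ne_of_mem_of_not_mem ha haS)]

theorem exists_isRamseyBound (k q m : ℕ) : ∃ N, IsRamseyBound.{u, v} k q m N := by
  classical
  induction k generalizing m with
  | zero =>
    refine ⟨m, fun _ A c hA => ?_⟩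
    obtain ⟨H, hHA, hH⟩ := exists_subset_card_eq hA
    exact ⟨H, hHA, hH, c ∅, fun S _ hS => by rw [card_eq_zero.1 hS]⟩
  | succ k ih =>
    obtain ⟨N, hN⟩ := exists_subset_color_eq_of_mem ih (q * m)
    refine ⟨N, fun {α κ} _ hκ A c hA => ?_⟩
    have := Fintype.ofFinite κ
    rw [Nat.card_eq_fintype_card] at hκ
    obtain ⟨H, hHA, hH, f, hf⟩ := hN (by rwa [Nat.card_eq_fintype_card]) A c hA
    obtain ⟨g, -, hg⟩ := exists_le_card_fiber_of_mul_le_card_of_maps_to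
      (fun a _ => mem_univ (f a)) ⟨c ∅, mem_univ _⟩ (hH ▸ Nat.mul_le_mul_right m hκ)
    obtain ⟨H', hH'H, hH'⟩ := exists_subset_card_eq hg
    refine ⟨H', (hH'H.trans (filter_subset _ _)).trans hHA, hH', g, fun S hS hk => ?_⟩
    obtain ⟨a, ha, hca⟩ := hf S (hS.trans (hH'H.trans (filter_subset _ _))) hk
    rw [hca, (mem_filter.1 (hH'H (hS ha))).2]

theorem exists_subset_color_eq_card (k q m : ℕ) :
    ∃ N, ∀ {α : Type u} {κ : Type v} [Finite κ], Nat.card κ ≤ q →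
      ∀ (A : Finset α) (c : Finset α → κ), N ≤ #A →
        ∃ H ⊆ A, #H = m ∧ ∃ g : ℕ → κ, ∀ S ⊆ H, #S < k → c S = g #S := by
  induction k with
  | zero =>
    refine ⟨m, fun _ A c hA => ?_⟩
    obtain ⟨H, hHA, hH⟩ := exists_subset_card_eq hA
    exact ⟨H, hHA, hH, fun _ => c ∅, fun S _ hS => absurd hS (Nat.not_lt_zero _)⟩
  | succ k ih =>
    obtain ⟨N₁, hN₁⟩ := ih
    obtain ⟨N₂, hN₂⟩ := exists_isRamseyBound.{u, v} k q N₁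
    refine ⟨N₂, fun hκ A c hA => ?_⟩
    obtain ⟨H₁, hH₁A, hH₁, g₁, hg₁⟩ := hN₂ hκ A c hA
    obtain ⟨H₂, hH₂H₁, hH₂, g₂, hg₂⟩ := hN₁ hκ H₁ c hH₁.ge
    refine ⟨H₂, hH₂H₁.trans hH₁A, hH₂, Function.update g₂ k g₁, fun S hS hk => ?_⟩
    rcases Nat.lt_succ_iff_lt_or_eq.1 hk with hlt | heq
    · rw [Function.update_of_ne hlt.ne, hg₂ S hS hlt]
    · rw [heq, Function.update_self, hg₁ S (hS.trans hH₂H₁) heq]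

theorem exists_subsets_color_eq_card (κ : Type w) [Finite κ] (k m : ℕ) :
    ∃ N, ∀ {α : Type u} {β : Type v} (A : Finset α) (B : Finset β)
      (c : Finset α → Finset β → κ), N ≤ #A → N ≤ #B →
        ∃ A' ⊆ A, ∃ B' ⊆ B, #A' = m ∧ #B' = m ∧ ∃ g : ℕ → ℕ → κ,
          ∀ S ⊆ A', ∀ T ⊆ B', #S < k → #T < k → c S T = g #S #T := by
  classical
  obtain ⟨M, hM⟩ := exists_subset_color_eq_card.{v, w} k (Nat.card (Fin k → κ)) m
  obtain ⟨N, hN⟩ := exists_subset_color_eq_card.{u, max v w} k (Nat.card κ ^ 2 ^ M) m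
  refine ⟨max M N, fun {α β} A B c hA hB => ?_⟩
  obtain ⟨B₁, hB₁B, hB₁⟩ := exists_subset_card_eq ((le_max_left M N).trans hB)
  have hcard : Nat.card (B₁.powerset → κ) ≤ Nat.card κ ^ 2 ^ M := by
    rw [Nat.card_fun, Nat.card_eq_fintype_card (α := B₁.powerset), Fintype.card_coe, card_powerset,
      hB₁]
  -- Cutting `B` down to the fixed size `M` first bounds the number of colours `T ↦ c S T` of `S`.
  obtain ⟨A', hA'A, hA', g₁, hg₁⟩ := hN hcard A (fun S T => c S T) ((le_max_right M N).trans hA)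
  obtain ⟨B', hB'B₁, hB', g₂, hg₂⟩ := hM le_rfl B₁
    (fun T a => if hT : T ∈ B₁.powerset then g₁ a ⟨T, hT⟩ else c ∅ ∅) hB₁.ge
  refine ⟨A', hA'A, B', hB'B₁.trans hB₁B, hA', hB',
    fun a b => if ha : a < k then g₂ b ⟨a, ha⟩ else c ∅ ∅, fun S hS T hT hSk hTk => ?_⟩
  have hTB₁ : T ∈ B₁.powerset := mem_powerset.2 (hT.trans hB'B₁)
  have hST : c S T = g₁ #S ⟨T, hTB₁⟩ := congrFun (hg₁ S hS hSk) ⟨T, hTB₁⟩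
  have hTg := congrFun (hg₂ T hT hTk) ⟨#S, hSk⟩
  rw [dif_pos hTB₁] at hTg
  simp only [hST, hTg, hSk, dif_pos]

/-! ### Densities -/

theorem sum_powerset_union {α M : Type*} [DecidableEq α] [AddCommMonoid M] {Z X : Finset α}
    (h : Disjoint Z X) (f : Finset α → M) :
    ∑ S ∈ (Z ∪ X).powerset, f S = ∑ U ∈ Z.powerset, ∑ S ∈ X.powerset, f (U ∪ S) := by
  have hunion : ∀ S ∈ (Z ∪ X).powerset, S ∩ Z ∪ S ∩ X = S := fun S hS => by
    rw [← inter_union_distrib_left, inter_eq_left.2 (mem_powerset.1 hS)]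
  rw [← sum_product']
  refine sum_nbij' (fun S => (S ∩ Z, S ∩ X)) (fun p => p.1 ∪ p.2) ?_ ?_ ?_ ?_ ?_
  · exact fun S _ => mem_product.2
      ⟨mem_powerset.2 inter_subset_right, mem_powerset.2 inter_subset_right⟩
  · exact fun p hp => mem_powerset.2 (union_subset_union (mem_powerset.1 (mem_product.1 hp).1)
      (mem_powerset.1 (mem_product.1 hp).2))
  · exact hunion
  · rintro ⟨U, S⟩ hp
    obtain ⟨hU, hS⟩ := mem_product.1 hp
    ext a <;> grind [disjoint_left]
  · exact fun S hS => by rw [hunion S hS]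

theorem expect_powerset_union {α M : Type*} [DecidableEq α] [AddCommMonoid M] [Module ℚ≥0 M]
    {Z X : Finset α} (h : Disjoint Z X) (f : Finset α → M) :
    𝔼 S ∈ (Z ∪ X).powerset, f S = 𝔼 U ∈ Z.powerset, 𝔼 S ∈ X.powerset, f (U ∪ S) := by
  simp only [expect, sum_powerset_union h, ← smul_sum, smul_smul, card_powerset,
    card_union_of_disjoint h, pow_add, Nat.cast_mul, mul_inv]

theorem expect_powerset_apply_card_congr {α β M : Type*} [AddCommMonoid M] [Module ℚ≥0 M]
    {A : Finset α} {B : Finset β} (h : #A = #B) (f : ℕ → M) :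
    𝔼 X ∈ A.powerset, f #X = 𝔼 X ∈ B.powerset, f #X := by
  simp only [expect, sum_powerset_apply_card, card_powerset, h]

theorem sum_range_mul {M : Type*} [AddCommMonoid M] (d n : ℕ) (f : ℕ → M) :
    ∑ x ∈ range (d * n), f x = ∑ r ∈ range d, ∑ i ∈ range n, f (r + d * i) := by
  rcases d.eq_zero_or_pos with rfl | hd
  · simp
  rw [← sum_product']
  refine sum_nbij' (fun x => (x % d, x / d)) (fun p => p.1 + d * p.2) ?_ ?_ ?_ ?_ ?_
  · exact fun x hx => mem_product.2 ⟨mem_range.2 (Nat.mod_lt x hd),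
      mem_range.2 (Nat.div_lt_of_lt_mul (mem_range.1 hx))⟩
  · rintro ⟨r, i⟩ hp
    have hr : r < d := mem_range.1 (mem_product.1 hp).1
    have hi : i < n := mem_range.1 (mem_product.1 hp).2
    have := Nat.mul_le_mul_left d hi
    exact mem_range.2 (by dsimp only; lia)
  · exact fun x _ => Nat.mod_add_div x d
  · rintro ⟨r, i⟩ hp
    have hr : r < d := mem_range.1 (mem_product.1 hp).1
    simp only [Nat.add_mul_mod_self_left, Nat.mod_eq_of_lt hr, Nat.add_mul_div_left _ _ hd,
      Nat.div_eq_of_lt hr, zero_add]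
  · exact fun x _ => by rw [Nat.mod_add_div]

theorem expect_range_mul {M : Type*} [AddCommMonoid M] [Module ℚ≥0 M] (d n : ℕ) (f : ℕ → M) :
    𝔼 x ∈ range (d * n), f x = 𝔼 r ∈ range d, 𝔼 i ∈ range n, f (r + d * i) := by
  simp only [expect, sum_range_mul, ← smul_sum, smul_smul, card_range, Nat.cast_mul, mul_inv]

open Classical in
/-- The proportion of the pairs `(x, y)` in `s × t` for which `P x y` holds, written as an iterated
average because the two blocks of variables are treated independently. -/
noncomputable def density {α β : Type*} (s : Finset α) (t : Finset β) (P : α → β → Prop) : ℝ :=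
  𝔼 x ∈ s, 𝔼 y ∈ t, if P x y then 1 else 0

section Density

variable {α β : Type*}

theorem density_eq_sum_div (s : Finset α) (t : Finset β) (P : α → β → Prop)
    [∀ x y, Decidable (P x y)] :
    density s t P = (∑ x ∈ s, ∑ y ∈ t, if P x y then 1 else 0 : ℕ) / (#s * #t) := by
  simp only [density, expect_eq_sum_div_card, ← sum_div, div_div, mul_comm (#t : ℝ)]
  push_cast
  congr!

theorem density_congr {s : Finset α} {t : Finset β} {P Q : α → β → Prop}
    (h : ∀ x ∈ s, ∀ y ∈ t, P x y ↔ Q x y) : density s t P = density s t Q := by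
  classical
  exact expect_congr rfl fun x hx => expect_congr rfl fun y hy => if_congr (h x hx y hy) rfl rfl

theorem density_mono {s : Finset α} {t : Finset β} {P Q : α → β → Prop}
    (h : ∀ x ∈ s, ∀ y ∈ t, P x y → Q x y) : density s t P ≤ density s t Q := by
  classical
  refine expect_le_expect fun x hx => expect_le_expect fun y hy => ?_
  by_cases hP : P x y
  · rw [if_pos hP, if_pos (h x hx y hy hP)]
  · rw [if_neg hP]
    positivity

theorem density_powerset_le_of_restrict [DecidableEq α] [DecidableEq β] {A A' : Finset α}
    {B B' : Finset β} (hA : A' ⊆ A) (hB : B' ⊆ B) {P : Finset α → Finset β → Prop} {δ : ℝ}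
    (h : ∀ Z ⊆ A \ A', ∀ W ⊆ B \ B',
      density A'.powerset B'.powerset (fun X Y => P (Z ∪ X) (W ∪ Y)) ≤ δ) :
    density A.powerset B.powerset P ≤ δ := by
  rw [density, ← sdiff_union_of_subset hA, ← sdiff_union_of_subset hB]
  simp only [expect_powerset_union sdiff_disjoint]
  refine expect_le (powerset_nonempty _) fun Z hZ => ?_
  rw [expect_comm]
  exact expect_le (powerset_nonempty _) fun W hW => h Z (mem_powerset.1 hZ) W (mem_powerset.1 hW)

theorem density_powerset_card_congr {α' β' : Type*} {A : Finset α} {B : Finset β} {A' : Finset α'}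
    {B' : Finset β'} (hA : #A = #A') (hB : #B = #B') (P : ℕ → ℕ → Prop) :
    density A.powerset B.powerset (fun X Y => P #X #Y) =
      density A'.powerset B'.powerset (fun X Y => P #X #Y) := by
  classical
  refine (expect_powerset_apply_card_congr hA
    fun x => 𝔼 Y ∈ B.powerset, if P x #Y then (1 : ℝ) else 0).trans ?_
  exact expect_congr rfl fun X _ =>
    expect_powerset_apply_card_congr hB fun y => if P #X y then (1 : ℝ) else 0

theorem density_range_mul (d n : ℕ) (P : ℕ → ℕ → Prop) :
    density (range (d * n)) (range (d * n)) P = 𝔼 r ∈ range d, 𝔼 s ∈ range d,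
      density (range n) (range n) (fun i k => P (r + d * i) (s + d * k)) := by
  simp only [density, expect_range_mul]
  exact expect_congr rfl fun r _ => expect_comm _ _ _

end Density

/-! ### Polynomials in two blocks of variables -/

section BlockPolynomials

variable {α β R : Type*}

/-- From degree `j` on, the polynomial with coefficients `c` is the blockwise symmetric polynomial
`∑ g a b e_a(x) e_b(y)` in the blocks `A` and `B`. -/
def AgreesFrom (j : ℕ) (A : Finset α) (B : Finset β) (c : Finset α → Finset β → R)
    (g : ℕ → ℕ → R) : Prop :=
  ∀ S ⊆ A, ∀ T ⊆ B, j ≤ #S + #T → c S T = g #S #T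

theorem AgreesFrom.mono {i j : ℕ} {A A' : Finset α} {B B' : Finset β}
    {c : Finset α → Finset β → R} {g : ℕ → ℕ → R} (h : AgreesFrom i A B c g) (hij : i ≤ j)
    (hA : A' ⊆ A) (hB : B' ⊆ B) : AgreesFrom j A' B' c g :=
  fun S hS T hT hj => h S (hS.trans hA) T (hT.trans hB) (hij.trans hj)

theorem AgreesFrom.ite {i j : ℕ} {A : Finset α} {B : Finset β} {c : Finset α → Finset β → R}
    {g t : ℕ → ℕ → R} (h : AgreesFrom i A B c g) (ht : AgreesFrom j A B c t) :
    AgreesFrom i A B c fun a b => if j ≤ a + b then t a b else g a b := by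
  intro S hS T hT hi
  dsimp only
  split_ifs with hj
  · exact ht S hS T hT hj
  · exact h S hS T hT hi

variable [AddCommMonoid R]

/-- The value of the multilinear polynomial `∑ c S T x^S y^T` in two blocks of variables at the
point whose coordinates equal to `1` are those in `X` and `Y`. -/
def blockEval (c : Finset α → Finset β → R) (X : Finset α) (Y : Finset β) : R :=
  ∑ S ∈ X.powerset, ∑ T ∈ Y.powerset, c S T

/-- The coefficients of the polynomial with coefficients `c` after the variables in `Z` and `W` have
been set to `1`. -/
def restrictCoeff [DecidableEq α] [DecidableEq β] (c : Finset α → Finset β → R) (Z : Finset α)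
    (W : Finset β) : Finset α → Finset β → R :=
  fun S T => ∑ U ∈ Z.powerset, ∑ V ∈ W.powerset, c (U ∪ S) (V ∪ T)

/-- The value of the blockwise symmetric polynomial `∑ g a b e_a(x) e_b(y)` at the points with `x`
ones in the first block and `y` ones in the second. -/
def symEval (g : ℕ → ℕ → R) (x y : ℕ) : R :=
  ∑ a ∈ range (x + 1), ∑ b ∈ range (y + 1), (x.choose a * y.choose b) • g a b

theorem blockEval_union [DecidableEq α] [DecidableEq β] (c : Finset α → Finset β → R)
    {Z X : Finset α} {W Y : Finset β} (hZX : Disjoint Z X) (hWY : Disjoint W Y) :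
    blockEval c (Z ∪ X) (W ∪ Y) = blockEval (restrictCoeff c Z W) X Y := by
  simp only [blockEval, restrictCoeff, sum_powerset_union hZX, sum_powerset_union hWY]
  rw [sum_comm]
  refine sum_congr rfl fun S _ => ?_
  rw [sum_comm (s := Y.powerset)]
  exact sum_congr rfl fun U _ => sum_comm

theorem blockEval_eq_symEval {A : Finset α} {B : Finset β} {c : Finset α → Finset β → R}
    {g : ℕ → ℕ → R} (h : AgreesFrom 0 A B c g) {X : Finset α} {Y : Finset β} (hX : X ⊆ A)
    (hY : Y ⊆ B) : blockEval c X Y = symEval g #X #Y := by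
  have hc : ∀ S ∈ X.powerset, ∑ T ∈ Y.powerset, c S T = ∑ T ∈ Y.powerset, g #S #T :=
    fun S hS => sum_congr rfl fun T hT => h S ((mem_powerset.1 hS).trans hX) T
      ((mem_powerset.1 hT).trans hY) (Nat.zero_le _)
  rw [blockEval, sum_congr rfl hc, sum_powerset_apply_card fun a => ∑ T ∈ Y.powerset, g a #T]
  simp only [sum_powerset_apply_card, smul_sum, smul_smul, symEval]

theorem AgreesFrom.restrict [DecidableEq α] [DecidableEq β] {j : ℕ} {A A' Z : Finset α}
    {B B' W : Finset β} {c : Finset α → Finset β → R} {g : ℕ → ℕ → R}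
    (h : AgreesFrom (j + 1) A B c g) (h' : AgreesFrom j A' B' c g) (hA : A' ⊆ A) (hB : B' ⊆ B)
    (hZ : Z ⊆ A \ A') (hW : W ⊆ B \ B') :
    AgreesFrom j A' B' (restrictCoeff c Z W)
      (fun a b => ∑ U ∈ Z.powerset, ∑ V ∈ W.powerset, g (#U + a) (#V + b)) := by
  intro S hS T hT hj
  refine sum_congr rfl fun U hU => sum_congr rfl fun V hV => ?_
  have hUA := (mem_powerset.1 hU).trans hZ
  have hVB := (mem_powerset.1 hV).trans hW
  rcases Nat.eq_zero_or_pos (#U + #V) with h0 | hpos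
  · obtain ⟨rfl, rfl⟩ : U = ∅ ∧ V = ∅ := by simpa only [Nat.add_eq_zero_iff, card_eq_zero] using h0
    simpa only [empty_union, card_empty, zero_add] using h' S hS T hT hj
  · have hUS : #(U ∪ S) = #U + #S := card_union_of_disjoint (sdiff_disjoint.mono hUA hS)
    have hVT : #(V ∪ T) = #V + #T := card_union_of_disjoint (sdiff_disjoint.mono hVB hT)
    rw [← hUS, ← hVT]
    exact h _ (union_subset (hUA.trans sdiff_subset) (hS.trans hA)) _
      (union_subset (hVB.trans sdiff_subset) (hT.trans hB)) (by lia)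

theorem AgreesFrom.restrict_top [DecidableEq α] [DecidableEq β] {D : ℕ} {A A' Z : Finset α}
    {B B' W : Finset β} {c : Finset α → Finset β → R} {t : ℕ → ℕ → R}
    (ht : ∀ a b, D < a + b → t a b = 0) (h : AgreesFrom D A B c t) (hA : A' ⊆ A) (hB : B' ⊆ B)
    (hZ : Z ⊆ A \ A') (hW : W ⊆ B \ B') : AgreesFrom D A' B' (restrictCoeff c Z W) t := by
  intro S hS T hT hD
  refine ((h.mono D.le_succ subset_rfl subset_rfl).restrict (h.mono le_rfl hA hB) hA hB hZ hW
    S hS T hT hD).trans ?_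
  dsimp only
  rw [← sum_product', sum_eq_single_of_mem (∅, ∅) (by simp)]
  · simp only [card_empty, zero_add]
  · rintro ⟨U, V⟩ - hne
    refine ht _ _ ?_
    have : 0 < #U + #V := by
      simpa only [Nat.pos_iff_ne_zero, ne_eq, Nat.add_eq_zero_iff, card_eq_zero, Prod.mk.injEq]
        using hne
    lia

theorem density_blockEval_eq_density_symEval {A : Finset α} {B : Finset β}
    {c : Finset α → Finset β → R} {g : ℕ → ℕ → R} (h : AgreesFrom 0 A B c g) (P : R → Prop) :
    density A.powerset B.powerset (fun X Y => P (blockEval c X Y)) =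
      density (range #A).powerset (range #B).powerset (fun X Y => P (symEval g #X #Y)) := by
  rw [density_congr fun X hX Y hY => by
    rw [blockEval_eq_symEval h (mem_powerset.1 hX) (mem_powerset.1 hY)]]
  exact density_powerset_card_congr (card_range #A).symm (card_range #B).symm
    fun x y => P (symEval g x y)

end BlockPolynomials

theorem exists_agreesFrom_of_agreesFrom_succ (R : Type w) [Finite R] (j m : ℕ) :
    ∃ N, ∀ {α : Type u} {β : Type v} {A : Finset α} {B : Finset β} {c : Finset α → Finset β → R}
      {g : ℕ → ℕ → R}, N ≤ #A → N ≤ #B → AgreesFrom (j + 1) A B c g →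
        ∃ A' ⊆ A, ∃ B' ⊆ B, #A' = m ∧ #B' = m ∧
          ∃ g', AgreesFrom (j + 1) A B c g' ∧ AgreesFrom j A' B' c g' := by
  obtain ⟨N, hN⟩ := exists_subsets_color_eq_card.{u, v} R (j + 1) m
  refine ⟨N, fun {α β A B c g} hA hB hcg => ?_⟩
  obtain ⟨A', hA', B', hB', hA'm, hB'm, g₁, hg₁⟩ := hN A B c hA hB
  refine ⟨A', hA', B', hB', hA'm, hB'm, fun a b => if a + b = j then g₁ a b else g a b,
    fun S hS T hT hST => (hcg S hS T hT hST).trans (if_neg (by lia)).symm,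
    fun S hS T hT hST => ?_⟩
  dsimp only
  split_ifs with hj
  · exact hg₁ S hS T hT (by lia) (by lia)
  · exact hcg S (hS.trans hA') T (hT.trans hB') (by lia)

theorem exists_density_blockEval_le {R : Type*} [AddCommMonoid R] [Finite R] {D : ℕ}
    {t : ℕ → ℕ → R} {P : R → Prop} {δ : ℝ} (ht : ∀ a b, D < a + b → t a b = 0)
    (hsym : ∀ᶠ p : ℕ × ℕ in atTop, ∀ g : ℕ → ℕ → R, (∀ a b, D ≤ a + b → g a b = t a b) →
      density (range p.1).powerset (range p.2).powerset (fun X Y => P (symEval g #X #Y)) ≤ δ) :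
    ∃ N, ∀ {α : Type u} {β : Type v} (A : Finset α) (B : Finset β) (c : Finset α → Finset β → R),
      N ≤ #A → N ≤ #B → AgreesFrom D A B c t →
        density A.powerset B.powerset (fun X Y => P (blockEval c X Y)) ≤ δ := by
  classical
  suffices ∀ j, ∃ N, ∀ {α : Type u} {β : Type v} (A : Finset α) (B : Finset β)
      (c : Finset α → Finset β → R), N ≤ #A → N ≤ #B → AgreesFrom D A B c t →
      (∃ g, AgreesFrom j A B c g) →
        density A.powerset B.powerset (fun X Y => P (blockEval c X Y)) ≤ δ by
    obtain ⟨N, hN⟩ := this D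
    exact ⟨N, fun A B c hA hB hc => hN A B c hA hB hc ⟨t, hc⟩⟩
  /- Alon–Beigel: if the coefficients are blockwise symmetric above degree `j`, Ramsey's theorem
  makes them so in degree `j` too on subblocks, and fixing the other variables arbitrarily keeps
  both this symmetry and the part of degree at least `D`. -/
  intro j
  induction j with
  | zero =>
    obtain ⟨N, hN⟩ := eventually_atTop_prod_self.1 hsym
    refine ⟨N, fun A B c hA hB hct ⟨g, hcg⟩ => ?_⟩
    rw [density_blockEval_eq_density_symEval (hcg.ite hct)]
    exact hN _ _ hA hB _ fun a b hD => if_pos hD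
  | succ j ih =>
    obtain ⟨m, hm⟩ := ih
    obtain ⟨N, hN⟩ := exists_agreesFrom_of_agreesFrom_succ R j m
    refine ⟨N, fun A B c hA hB hct ⟨g, hcg⟩ => ?_⟩
    obtain ⟨A', hA', B', hB', hA'm, hB'm, g', hc, hc'⟩ := hN hA hB hcg
    refine density_powerset_le_of_restrict hA' hB' fun Z hZ W hW => ?_
    rw [density_congr fun X hX Y hY => by
      rw [blockEval_union c (sdiff_disjoint.mono hZ (mem_powerset.1 hX))
        (sdiff_disjoint.mono hW (mem_powerset.1 hY))]]
    exact hm A' B' _ hA'm.ge hB'm.ge (hct.restrict_top ht hA' hB' hZ hW)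
      ⟨_, hc.restrict hc' hA' hB' hZ hW⟩

/-! ### Equidistribution of block weights -/

section Equidistribution

theorem norm_one_add_lt_two {z : ℂ} (hz : ‖z‖ = 1) (h1 : z ≠ 1) : ‖1 + z‖ < 2 := by
  have hray : ¬ SameRay ℝ 1 z := fun h => h1 (h.eq_of_norm_eq (by rw [norm_one, hz])).symm
  calc ‖1 + z‖ < ‖(1 : ℂ)‖ + ‖z‖ := norm_add_lt_of_not_sameRay hray
    _ = 2 := by rw [norm_one, hz, one_add_one_eq_two]

theorem expect_powerset_pow_card {α : Type*} (A : Finset α) (z : ℂ) :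
    𝔼 X ∈ A.powerset, z ^ #X = ((1 + z) / 2) ^ #A := by
  have := sum_pow_mul_eq_add_pow z 1 A
  simp only [one_pow, mul_one] at this
  rw [expect_eq_sum_div_card, this, card_powerset, add_comm, div_pow, Nat.cast_pow, Nat.cast_ofNat]

variable {m : ℕ} [NeZero m]

theorem tendsto_expect_powerset_addChar (ψ : AddChar (ZMod m) ℂ) :
    Tendsto (fun n => 𝔼 X ∈ (range n).powerset, ψ #X) atTop (𝓝 (𝔼 r, ψ r)) := by
  have hψ (k : ℕ) : ψ k = ψ 1 ^ k := by rw [← nsmul_one, AddChar.map_nsmul_eq_pow]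
  simp only [hψ, expect_powerset_pow_card, card_range, AddChar.expect_eq_ite]
  split_ifs with h0
  · simp [h0]
  · have h1 : ψ 1 ≠ 1 := fun h1 => h0 <| by
      ext r
      rw [← ZMod.natCast_zmod_val r, hψ, h1, one_pow, AddChar.zero_apply]
    refine tendsto_pow_atTop_nhds_zero_of_norm_lt_one ?_
    rw [norm_div, RCLike.norm_ofNat, div_lt_one two_pos]
    exact norm_one_add_lt_two (ψ.norm_apply 1) h1

theorem tendsto_expect_powerset (f : ZMod m → ℂ) :
    Tendsto (fun n => 𝔼 X ∈ (range n).powerset, f #X) atTop (𝓝 (𝔼 r, f r)) := by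
  have hf : f ∈ Submodule.span ℂ (Set.range (AddChar.complexBasis (ZMod m))) :=
    (AddChar.complexBasis (ZMod m)).mem_span f
  induction hf using Submodule.span_induction with
  | mem f hf =>
    obtain ⟨ψ, rfl⟩ := hf
    rw [AddChar.complexBasis_apply]
    exact tendsto_expect_powerset_addChar ψ
  | zero => simp
  | add f g _ _ hf hg => simpa only [Pi.add_apply, expect_add_distrib] using hf.add hg
  | smul c f _ hf => simpa only [Pi.smul_apply, ← smul_expect] using hf.const_smul c

theorem tendsto_expect_powerset_real (f : ZMod m → ℝ) :
    Tendsto (fun n => 𝔼 X ∈ (range n).powerset, f #X) atTop (𝓝 (𝔼 r, f r)) := by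
  have := tendsto_expect_powerset fun r => (f r : ℂ)
  simpa only [← Complex.ofReal_expect, tendsto_ofReal_iff] using this

theorem tendsto_expect_powerset_powerset (f : ZMod m → ZMod m → ℝ) :
    Tendsto (fun p : ℕ × ℕ => 𝔼 X ∈ (range p.1).powerset, 𝔼 Y ∈ (range p.2).powerset, f #X #Y)
      atTop (𝓝 (𝔼 r, 𝔼 s, f r s)) := by
  have hsplit (a : ZMod m) (g : ZMod m → ℝ) : g a = ∑ r, (if a = r then 1 else 0) * g r := by simp
  have hfst : Tendsto Prod.fst (atTop : Filter (ℕ × ℕ)) atTop :=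
    prod_atTop_atTop_eq (α := ℕ) (β := ℕ) ▸ tendsto_fst
  have hsnd : Tendsto Prod.snd (atTop : Filter (ℕ × ℕ)) atTop :=
    prod_atTop_atTop_eq (α := ℕ) (β := ℕ) ▸ tendsto_snd
  have hlim := tendsto_finsetSum univ fun r (_ : r ∈ univ) =>
    ((tendsto_expect_powerset_real fun a : ZMod m => if a = r then 1 else 0).comp hfst).mul
      ((tendsto_expect_powerset_real (f r)).comp hsnd)
  refine (hlim.congr fun p => ?_).trans_eq ?_
  · simp only [Function.comp_apply, expect_mul, ← expect_sum_comm]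
    exact expect_congr rfl fun X _ => (hsplit #X fun r => 𝔼 Y ∈ (range p.2).powerset, f r #Y).symm
  · simp only [expect_mul, ← expect_sum_comm]
    exact congrArg 𝓝 (expect_congr rfl fun a _ => (hsplit a fun r => 𝔼 s, f r s).symm)

theorem density_zmod_val (P : ℕ → ℕ → Prop) :
    density univ univ (fun r s : ZMod m => P r.val s.val) = density (range m) (range m) P := by
  have hval (f : ℕ → ℝ) : 𝔼 r : ZMod m, f r.val = 𝔼 r ∈ range m, f r := by
    refine expect_nbij' ZMod.val (fun k => (k : ZMod m)) ?_ ?_ ?_ ?_ ?_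
    · simp [ZMod.val_lt]
    · simp
    · simp
    · exact fun k hk => ZMod.val_cast_of_lt (mem_range.1 hk)
    · simp
  classical
  refine (hval fun r => 𝔼 s : ZMod m, if P r s.val then 1 else 0).trans ?_
  exact expect_congr rfl fun r _ => hval fun s => if P r s then 1 else 0

theorem eventually_abs_density_powerset_sub_le {ε : ℝ} (hε : 0 < ε) :
    ∀ᶠ p : ℕ × ℕ in atTop, ∀ P : ℕ → ℕ → Prop, (∀ x y, P (x % m) (y % m) ↔ P x y) →
      |density (range p.1).powerset (range p.2).powerset (fun X Y => P #X #Y) -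
        density (range m) (range m) P| ≤ ε := by
  classical
  have hQ (Q : ZMod m → ZMod m → Prop) : ∀ᶠ p : ℕ × ℕ in atTop,
      |density (range p.1).powerset (range p.2).powerset (fun X Y => Q #X #Y) -
        density univ univ Q| ≤ ε := by
    have := tendsto_expect_powerset_powerset fun r s => if Q r s then (1 : ℝ) else 0
    filter_upwards [this.eventually (Metric.closedBall_mem_nhds _ hε)] with p hp using hp
  filter_upwards [eventually_all.2 hQ] with p hp P hP
  have := hp fun r s => P r.val s.val
  simp only [ZMod.val_natCast, hP, density_zmod_val] at this
  exact this

end Equidistribution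

/-! ### Lucas' theorem and the cubic leading form -/

section Lucas

variable {p : ℕ} [Fact p.Prime]

theorem choose_eq_choose_mod_pow_mul_choose_div_pow (l n k : ℕ) :
    (n.choose k : ZMod p) =
      (n % p ^ l).choose (k % p ^ l) * (n / p ^ l).choose (k / p ^ l) := by
  have lucas (n k : ℕ) :
      (n.choose k : ZMod p) = (n % p).choose (k % p) * (n / p).choose (k / p) := by
    exact_mod_cast (ZMod.natCast_eq_natCast_iff _ _ _).2
      (Choose.choose_modEq_choose_mod_mul_choose_div_nat (p := p) (n := n) (k := k))
  induction l generalizing n k with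
  | zero => simp [Nat.mod_one]
  | succ l ih =>
    rw [pow_succ', lucas n k, ih (n / p), lucas (n % (p * p ^ l))]
    simp only [Nat.mod_mul_right_mod, Nat.mod_mul_right_div_self, Nat.div_div_eq_div_mul, mul_assoc]

theorem choose_mod_pow {l k : ℕ} (hk : k < p ^ l) (n : ℕ) :
    ((n % p ^ l).choose k : ZMod p) = n.choose k := by
  rw [choose_eq_choose_mod_pow_mul_choose_div_pow l n k, Nat.mod_eq_of_lt hk, Nat.div_eq_of_lt hk,
    Nat.choose_zero_right, Nat.cast_one, mul_one]

theorem choose_pow (l n : ℕ) : (n.choose (p ^ l) : ZMod p) = (n / p ^ l : ℕ) := by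
  have hpos : 0 < p ^ l := pow_pos (Fact.out : p.Prime).pos l
  rw [choose_eq_choose_mod_pow_mul_choose_div_pow l, Nat.mod_self, Nat.div_self hpos,
    Nat.choose_zero_right, Nat.choose_one_right, Nat.cast_one, one_mul]

theorem choose_add_pow_mul {l r u : ℕ} (hr : r < p ^ l) (hu : u < p ^ l) (i a : ℕ) :
    ((r + p ^ l * i).choose (u + p ^ l * a) : ZMod p) = r.choose u * i.choose a := by
  have hpos : 0 < p ^ l := pow_pos (Fact.out : p.Prime).pos l
  rw [choose_eq_choose_mod_pow_mul_choose_div_pow l]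
  simp only [Nat.add_mul_mod_self_left, Nat.add_mul_div_left _ _ hpos, Nat.mod_eq_of_lt hr,
    Nat.mod_eq_of_lt hu, Nat.div_eq_of_lt hr, Nat.div_eq_of_lt hu, zero_add]

end Lucas

section SymEval

section AddCommMonoid

variable {R : Type*} [AddCommMonoid R]

theorem symEval_eq_sum_range {g : ℕ → ℕ → R} {m x y : ℕ}
    (h : ∀ a b, m ≤ a ∨ m ≤ b → (x.choose a * y.choose b) • g a b = 0) :
    symEval g x y = ∑ a ∈ range m, ∑ b ∈ range m, (x.choose a * y.choose b) • g a b := by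
  rw [symEval, ← sum_product', ← sum_product']
  refine sum_congr_of_eq_on_inter (fun p _ hp => h _ _ ?_) (fun p _ hp => ?_) fun _ _ _ => rfl
  · by_contra! hlt
    exact hp (mem_product.2 ⟨mem_range.2 hlt.1, mem_range.2 hlt.2⟩)
  · obtain hx | hy : x < p.1 ∨ y < p.2 := by
      by_contra! hle
      exact hp (mem_product.2 ⟨mem_range_succ_iff.2 hle.1, mem_range_succ_iff.2 hle.2⟩)
    · rw [Nat.choose_eq_zero_of_lt hx, zero_mul, zero_smul]
    · rw [Nat.choose_eq_zero_of_lt hy, mul_zero, zero_smul]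

theorem symEval_eq_sum_range_of_lt (g : ℕ → ℕ → R) {m x y : ℕ} (hx : x < m) (hy : y < m) :
    symEval g x y = ∑ a ∈ range m, ∑ b ∈ range m, (x.choose a * y.choose b) • g a b := by
  refine symEval_eq_sum_range fun a b hab => ?_
  rcases hab with ha | hb
  · rw [Nat.choose_eq_zero_of_lt (hx.trans_le ha), zero_mul, zero_smul]
  · rw [Nat.choose_eq_zero_of_lt (hy.trans_le hb), mul_zero, zero_smul]

theorem symEval_of_eq_zero {g : ℕ → ℕ → R} (h : ∀ a b, 0 < a + b → g a b = 0) (x y : ℕ) :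
    symEval g x y = g 0 0 := by
  rw [symEval_eq_sum_range (m := 1) fun a b hab => by rw [h a b (by lia), smul_zero]]
  simp

end AddCommMonoid

variable {p : ℕ} [Fact p.Prime]

theorem symEval_mod_pow {l : ℕ} {g : ℕ → ℕ → ZMod p} (hg : ∀ a b, p ^ l ≤ a ∨ p ^ l ≤ b → g a b = 0)
    (x y : ℕ) : symEval g (x % p ^ l) (y % p ^ l) = symEval g x y := by
  have hsum (x y : ℕ) := symEval_eq_sum_range (g := g) (m := p ^ l) (x := x) (y := y)
    fun a b hab => by rw [hg a b hab, smul_zero]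
  rw [hsum, hsum]
  refine sum_congr rfl fun a ha => sum_congr rfl fun b hb => ?_
  simp only [nsmul_eq_mul, Nat.cast_mul, choose_mod_pow (mem_range.1 ha),
    choose_mod_pow (mem_range.1 hb)]

theorem symEval_add_pow_mul {l r s : ℕ} (hr : r < p ^ l) (hs : s < p ^ l) (g : ℕ → ℕ → ZMod p)
    (i k : ℕ) :
    symEval g (r + p ^ l * i) (s + p ^ l * k) =
      symEval (fun a b => symEval (fun u v => g (u + p ^ l * a) (v + p ^ l * b)) r s) i k := by
  obtain ⟨n, hi, hk⟩ : ∃ n, i < n ∧ k < n := ⟨max i k + 1, by lia, by lia⟩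
  have hlt {r i : ℕ} (hr : r < p ^ l) (hi : i < n) : r + p ^ l * i < p ^ l * n := by
    have := Nat.mul_le_mul_left (p ^ l) hi
    lia
  rw [symEval_eq_sum_range_of_lt _ (hlt hr hi) (hlt hs hk), symEval_eq_sum_range_of_lt _ hi hk,
    sum_range_mul, sum_comm]
  refine sum_congr rfl fun a _ => ?_
  simp only [sum_range_mul, symEval_eq_sum_range_of_lt _ hr hs, smul_sum]
  rw [sum_congr rfl fun u _ => sum_comm, sum_comm]
  refine sum_congr rfl fun b _ => sum_congr rfl fun u hu => sum_congr rfl fun v hv => ?_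
  simp only [nsmul_eq_mul, Nat.cast_mul, choose_add_pow_mul hr (mem_range.1 hu),
    choose_add_pow_mul hs (mem_range.1 hv)]
  ring

end SymEval

section CrossTop

/-- The coefficients, in terms of the elementary symmetric polynomials of two blocks of variables,
of `e_d(x) e_{2d}(y) + e_{2d}(x) e_d(y)` over `ℤ/2ℤ`. -/
def crossTop (d a b : ℕ) : ZMod 2 := if a = d ∧ b = 2 * d ∨ a = 2 * d ∧ b = d then 1 else 0

theorem crossTop_of_lt {d a b : ℕ} (h : 3 * d < a + b) : crossTop d a b = 0 :=
  if_neg (by lia)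

theorem crossTop_mul {d : ℕ} (hd : 0 < d) (e a b : ℕ) :
    crossTop (d * e) (d * a) (d * b) = crossTop e a b := by
  have h (a e : ℕ) : d * a = d * e ↔ a = e := Nat.mul_right_inj hd.ne'
  simp only [crossTop, mul_left_comm 2 d, h]

/- Splitting `i = i₀ + 2 i₁` and `k = k₀ + 2 k₁`, the cubic becomes an affine function of `(i₁, k₁)`
with linear part `(t + k₀) i₁ + (u + i₀) k₁`, hence is balanced unless `(i₀, k₀) = (u, t)`. -/
theorem card_zeros_cubic_le : ∀ p q r s t u : ZMod 2,
    (∑ i ∈ range 4, ∑ k ∈ range 4,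
      if p + q * i + r * k + s * i * k + t * i.choose 2 + u * k.choose 2 +
        i * k.choose 2 + i.choose 2 * k = 0 then 1 else 0) ≤ 10 := by
  decide

theorem density_symEval_cubic_le {g : ℕ → ℕ → ZMod 2}
    (hg : ∀ a b, 3 ≤ a + b → g a b = crossTop 1 a b) :
    density (range 4) (range 4) (fun i k => symEval g i k = 0) ≤ 5 / 8 := by
  have htop (a b : ℕ) (hab : 3 ≤ a + b) : g a b =
      if a = 1 ∧ b = 2 ∨ a = 2 ∧ b = 1 then 1 else 0 := hg a b hab
  have hcubic (i : ℕ) (hi : i ∈ range 4) (k : ℕ) (hk : k ∈ range 4) :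
      symEval g i k = g 0 0 + g 1 0 * i + g 0 1 * k + g 1 1 * i * k + g 2 0 * i.choose 2 +
        g 0 2 * k.choose 2 + i * k.choose 2 + i.choose 2 * k := by
    rw [symEval_eq_sum_range_of_lt g (mem_range.1 hi) (mem_range.1 hk)]
    simp only [nsmul_eq_mul, Nat.cast_mul, sum_range_succ, range_one, sum_singleton,
      Nat.choose_zero_right, Nat.cast_one, mul_one, Nat.choose_one_right, one_mul, zero_add,
      Std.le_refl, htop 0 3, zero_ne_one, Nat.succ_ne_self, and_self, OfNat.zero_ne_ofNat,
      OfNat.ofNat_ne_one, or_self, ↓reduceIte, mul_zero, add_zero, Nat.reduceAdd, htop 1 2,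
      OfNat.one_ne_ofNat, or_false, Nat.reduceLeDiff, htop 1 3, and_false, htop 2 1, or_true,
      htop 2 2, and_true, htop 2 3, htop 3 0, htop 3 1, htop 3 2, htop 3 3]
    ring
  rw [density_congr fun i hi k hk => by rw [hcubic i hi k hk]]
  rw [density_eq_sum_div, card_range, div_le_iff₀ (by norm_num)]
  exact (Nat.cast_le.2 (card_zeros_cubic_le (g 0 0) (g 1 0) (g 0 1) (g 1 1) (g 2 0)
    (g 0 2))).trans (by norm_num)

theorem density_symEval_le {l : ℕ} {g : ℕ → ℕ → ZMod 2}
    (hg : ∀ a b, 3 * 2 ^ l ≤ a + b → g a b = crossTop (2 ^ l) a b) :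
    density (range (2 ^ l * 4)) (range (2 ^ l * 4)) (fun x y => symEval g x y = 0) ≤ 5 / 8 := by
  have hl : 0 < 2 ^ l := Nat.two_pow_pos l
  rw [density_range_mul]
  refine expect_le (nonempty_range_iff.2 hl.ne') fun r hr =>
    expect_le (nonempty_range_iff.2 hl.ne') fun s hs => ?_
  simp only [symEval_add_pow_mul (mem_range.1 hr) (mem_range.1 hs)]
  refine density_symEval_cubic_le fun a b hab => ?_
  have hle : 3 * 2 ^ l ≤ 2 ^ l * a + 2 ^ l * b := by
    rw [mul_comm, ← mul_add]
    exact Nat.mul_le_mul_left _ hab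
  rw [symEval_of_eq_zero fun u v huv => by rw [hg _ _ (by lia), crossTop_of_lt (by lia)], zero_add,
    zero_add, hg _ _ hle]
  simpa only [mul_one] using crossTop_mul hl 1 a b

theorem eventually_density_symEval_le (l : ℕ) {ε : ℝ} (hε : 0 < ε) :
    ∀ᶠ p : ℕ × ℕ in atTop, ∀ g : ℕ → ℕ → ZMod 2,
      (∀ a b, 3 * 2 ^ l ≤ a + b → g a b = crossTop (2 ^ l) a b) →
        density (range p.1).powerset (range p.2).powerset (fun X Y => symEval g #X #Y = 0) ≤
          5 / 8 + ε := by
  have hpow : 2 ^ l * 4 = 2 ^ (l + 2) := by rw [pow_add]; rfl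
  filter_upwards [eventually_abs_density_powerset_sub_le (m := 2 ^ (l + 2)) hε] with p hp g hg
  have hvanish (a b : ℕ) (h : 2 ^ (l + 2) ≤ a ∨ 2 ^ (l + 2) ≤ b) : g a b = 0 := by
    have hl : 0 < 2 ^ l := Nat.two_pow_pos l
    rw [hg a b (by lia), crossTop_of_lt (by lia)]
  have hclose := hp (fun x y => symEval g x y = 0) fun x y => by rw [symEval_mod_pow hvanish]
  have hperiod := density_symEval_le hg
  rw [hpow] at hperiod
  linarith [(abs_le.1 hclose).2]

end CrossTop

/-! ### The lift modulo `4` -/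

section LiftModFour

theorem two_mul_natCast_zmod_four (n : ℕ) :
    (2 : ZMod 4) * n = if (n : ZMod 2) = 1 then 2 else 0 := by
  have hfour : (2 : ZMod 4) * 2 = 0 := by decide
  rcases Nat.even_or_odd' n with ⟨t, rfl | rfl⟩
  · simp [CharTwo.two_eq_zero, ← mul_assoc, hfour]
  · simp [CharTwo.two_eq_zero, mul_add, ← mul_assoc, hfour]

theorem choose_two_mul_two_pow (l : ℕ) : ((2 * 2 ^ l).choose (2 ^ l) : ZMod 4) = 2 := by
  obtain ⟨m, hm⟩ : ∃ m, 2 ^ l = m + 1 := Nat.exists_eq_succ_of_ne_zero (Nat.two_pow_pos l).ne'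
  have hhalf : (2 * 2 ^ l).choose (2 ^ l) = 2 * (2 * m + 1).choose (2 ^ l) := by
    rw [hm, mul_add, Nat.choose_succ_succ, ← Nat.choose_symm_half, two_mul, two_mul]
  have hodd : ((2 * m + 1).choose (2 ^ l) : ZMod 2) = 1 := by
    rw [choose_pow, show 2 * m + 1 = m + 2 ^ l by lia, Nat.add_div_right _ (Nat.two_pow_pos l),
      Nat.div_eq_of_lt (by lia), Nat.cast_one]
  rw [hhalf, Nat.cast_mul, Nat.cast_two, two_mul_natCast_zmod_four, if_pos hodd]

theorem choose_two_pow_eq_two_mul_choose {l x : ℕ} (h : (x.choose (2 ^ l) : ZMod 2) = 0) :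
    (x.choose (2 ^ l) : ZMod 4) = 2 * x.choose (2 * 2 ^ l) := by
  rcases lt_or_ge x (2 ^ l) with hx | hx
  · rw [Nat.choose_eq_zero_of_lt hx, Nat.choose_eq_zero_of_lt (by lia), Nat.cast_zero, mul_zero]
  obtain ⟨y, rfl⟩ := Nat.exists_eq_add_of_le' hx
  obtain ⟨t, ht⟩ : 2 ∣ (y + 2 ^ l).choose (2 ^ l) := (ZMod.natCast_eq_zero_iff _ _).1 h
  have hodd : (y.choose (2 ^ l) : ZMod 2) = 1 := by
    rw [choose_pow, Nat.add_div_right _ (Nat.two_pow_pos l), Nat.cast_succ,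
      CharTwo.add_eq_zero] at h
    rw [choose_pow, h]
  have hmul : (y + 2 ^ l).choose (2 * 2 ^ l) * (2 * 2 ^ l).choose (2 ^ l) =
      (y + 2 ^ l).choose (2 ^ l) * y.choose (2 ^ l) := by
    rw [Nat.choose_mul (by lia), Nat.add_sub_cancel, two_mul, Nat.add_sub_cancel]
  calc ((y + 2 ^ l).choose (2 ^ l) : ZMod 4)
    _ = 2 * (t * y.choose (2 ^ l) : ℕ) := by
      rw [ht, Nat.cast_mul, Nat.cast_two, two_mul_natCast_zmod_four, two_mul_natCast_zmod_four,
        Nat.cast_mul, hodd, mul_one]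
    _ = ((y + 2 ^ l).choose (2 ^ l) * y.choose (2 ^ l) : ℕ) := by
      rw [ht]
      push_cast
      ring
    _ = 2 * (y + 2 ^ l).choose (2 * 2 ^ l) := by
      rw [← hmul, Nat.cast_mul, choose_two_mul_two_pow, mul_comm]

theorem symEval_crossTop {d : ℕ} (hd : 0 < d) (x y : ℕ) :
    symEval (crossTop d) x y =
      (x.choose d * y.choose (2 * d) + x.choose (2 * d) * y.choose d : ℕ) := by
  have hsplit (a b : ℕ) : crossTop d a b =
      (if a = d then 1 else 0) * (if b = 2 * d then 1 else 0) +
        (if a = 2 * d then 1 else 0) * (if b = d then 1 else 0) := by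
    rw [crossTop]
    split_ifs <;> first | lia | rfl
  have hsum (n k : ℕ) :
      ∑ a ∈ range (n + 1), (n.choose a : ZMod 2) * (if a = k then 1 else 0) = n.choose k := by
    simp only [mul_ite, mul_one, mul_zero, sum_ite_eq', mem_range, ite_eq_left_iff]
    exact fun h => by rw [Nat.choose_eq_zero_of_lt (by lia), Nat.cast_zero]
  simp only [symEval, hsplit, nsmul_eq_mul, Nat.cast_mul, mul_add, mul_mul_mul_comm _ _ (ite ..),
    sum_add_distrib, ← sum_mul_sum, hsum, Nat.cast_add]

theorem ite_symEval_crossTop_eq_choose_mul_choose {l x y : ℕ}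
    (h : (x.choose (2 ^ l) : ZMod 2) = 0 ∨ (y.choose (2 ^ l) : ZMod 2) = 0) :
    (if symEval (crossTop (2 ^ l)) x y = 1 then (2 : ZMod 4) else 0) =
      x.choose (2 ^ l) * y.choose (2 ^ l) := by
  rw [symEval_crossTop (Nat.two_pow_pos l)]
  rcases h with hx | hy
  · rw [Nat.cast_add, Nat.cast_mul, hx, zero_mul, zero_add, ← two_mul_natCast_zmod_four,
      choose_two_pow_eq_two_mul_choose hx, Nat.cast_mul, mul_assoc]
  · rw [Nat.cast_add, Nat.cast_mul _ (y.choose _), Nat.cast_mul _ (y.choose _), hy, mul_zero,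
      add_zero, ← Nat.cast_mul, ← two_mul_natCast_zmod_four,
      choose_two_pow_eq_two_mul_choose hy, Nat.cast_mul, mul_left_comm]

theorem density_choose_even (l : ℕ) :
    density (range (2 ^ l * 2)) (range (2 ^ l * 2)) (fun x y =>
      (x.choose (2 ^ l) : ZMod 2) = 0 ∨ (y.choose (2 ^ l) : ZMod 2) = 0) = 3 / 4 := by
  have hl : 0 < 2 ^ l := Nat.two_pow_pos l
  have hne : (range (2 ^ l)).Nonempty := nonempty_range_iff.2 hl.ne'
  have hdigit {r : ℕ} (hr : r ∈ range (2 ^ l)) (i : ℕ) :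
      ((r + 2 ^ l * i).choose (2 ^ l) : ZMod 2) = i := by
    rw [choose_pow, Nat.add_mul_div_left _ _ hl, Nat.div_eq_of_lt (mem_range.1 hr), zero_add]
  have hcount : ∑ i ∈ range 2, ∑ k ∈ range 2,
      (if (i : ZMod 2) = 0 ∨ (k : ZMod 2) = 0 then 1 else 0) = 3 := by decide
  rw [density_range_mul]
  refine (expect_congr rfl fun r hr => expect_congr rfl fun s hs => ?_).trans
    ((expect_const hne _).trans (expect_const hne (3 / 4)))
  simp only [hdigit hr, hdigit hs]
  rw [density_eq_sum_div, hcount, card_range]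
  norm_num

theorem eventually_le_density_choose_even (l : ℕ) {ε : ℝ} (hε : 0 < ε) :
    ∀ᶠ p : ℕ × ℕ in atTop, 3 / 4 - ε ≤
      density (range p.1).powerset (range p.2).powerset (fun X Y =>
        ((#X).choose (2 ^ l) : ZMod 2) = 0 ∨ ((#Y).choose (2 ^ l) : ZMod 2) = 0) := by
  have hlt : 2 ^ l < 2 ^ (l + 1) := Nat.pow_lt_pow_right one_lt_two l.lt_succ_self
  filter_upwards [eventually_abs_density_powerset_sub_le (m := 2 ^ (l + 1)) hε] with p hp
  have hclose := hp (fun x y => (x.choose (2 ^ l) : ZMod 2) = 0 ∨ (y.choose (2 ^ l) : ZMod 2) = 0)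
    fun x y => by rw [choose_mod_pow hlt, choose_mod_pow hlt]
  rw [pow_succ, density_choose_even] at hclose
  linarith [(abs_le.1 hclose).1]

end LiftModFour

/-! ### Functions on the cube -/

section Cube

variable {ι : Type*}

/-- The set of the coordinates in `A` at which `z` equals `1`. -/
def onesIn (A : Finset ι) (z : ι → Bool) : Finset ι := {i ∈ A | z i}

theorem onesIn_subset (A : Finset ι) (z : ι → Bool) : onesIn A z ⊆ A := filter_subset _ _

variable [Fintype ι]

theorem exists_polyFun_eq_sum_powerset {R : Type*} [CommSemiring R] (Q : MvPolynomial ι R) :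
    ∃ q : Finset ι → R, (∀ T, Q.totalDegree < #T → q T = 0) ∧
      ∀ z, polyFun Q z = ∑ T ∈ (onesIn univ z).powerset, q T := by
  classical
  refine ⟨fun T => ∑ m ∈ Q.support with m.support = T, Q.coeff m, fun T hT => ?_, fun z => ?_⟩
  · refine sum_eq_zero fun m hm => ?_
    obtain ⟨hmQ, rfl⟩ := mem_filter.1 hm
    have hcard : #m.support ≤ m.sum fun _ e => e := by
      rw [card_eq_sum_ones]
      exact sum_le_sum fun i hi => Nat.one_le_iff_ne_zero.2 (Finsupp.mem_support_iff.1 hi)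
    exact absurd (hcard.trans (MvPolynomial.le_totalDegree hmQ)) hT.not_ge
  · rw [sum_fiberwise_eq_sum_filter, polyFun, MvPolynomial.eval_eq, sum_filter]
    refine sum_congr rfl fun m _ => ?_
    have hprod : ∏ i ∈ m.support, (if z i then (1 : R) else 0) ^ m i =
        if m.support ⊆ onesIn univ z then 1 else 0 := by
      rw [prod_congr rfl fun i hi => by
        rw [ite_pow, one_pow, zero_pow (Finsupp.mem_support_iff.1 hi)]]
      simp [prod_ite_zero, subset_iff, onesIn]
    rw [hprod, mul_ite, mul_one, mul_zero]
    simp only [mem_powerset]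

variable [DecidableEq ι]

theorem onesIn_union_onesIn_compl (A : Finset ι) (z : ι → Bool) :
    onesIn A z ∪ onesIn Aᶜ z = onesIn univ z := by
  rw [onesIn, onesIn, ← filter_union, union_compl, onesIn]

theorem disjoint_onesIn_onesIn_compl (A : Finset ι) (z : ι → Bool) :
    Disjoint (onesIn A z) (onesIn Aᶜ z) :=
  disjoint_compl_right.mono (onesIn_subset A z) (onesIn_subset Aᶜ z)

theorem expect_cube {M : Type*} [AddCommMonoid M] [Module ℚ≥0 M] (A : Finset ι)
    (f : Finset ι → Finset ι → M) :
    𝔼 z : ι → Bool, f (onesIn A z) (onesIn Aᶜ z) =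
      𝔼 X ∈ A.powerset, 𝔼 Y ∈ Aᶜ.powerset, f X Y := by
  have hcube : 𝔼 z : ι → Bool, f (onesIn A z) (onesIn Aᶜ z) =
      𝔼 S ∈ (univ : Finset ι).powerset, f (A ∩ S) (Aᶜ ∩ S) := by
    refine expect_nbij' (fun z => onesIn univ z) (fun S i => decide (i ∈ S)) ?_ ?_ ?_ ?_ ?_
    · simp
    · simp
    · exact fun z _ => by ext i; simp [onesIn]
    · exact fun S _ => by ext i; simp [onesIn]
    · exact fun z _ => by simp [onesIn, inter_filter]
  rw [hcube, ← union_compl A, expect_powerset_union disjoint_compl_right]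
  refine expect_congr rfl fun X hX => expect_congr rfl fun Y hY => ?_
  rw [mem_powerset] at hX hY
  rw [inter_union_distrib_left, inter_union_distrib_left, inter_eq_right.2 hX, inter_eq_right.2 hY,
    disjoint_iff_inter_eq_empty.1 (disjoint_compl_right.mono_right hY),
    disjoint_iff_inter_eq_empty.1 (disjoint_compl_left.mono_right hX), union_empty, empty_union]

theorem agr_eq_density {R : Type*} [DecidableEq R] {A : Finset ι} {f g : (ι → Bool) → R}
    {P : Finset ι → Finset ι → Prop} (h : ∀ z, f z = g z ↔ P (onesIn A z) (onesIn Aᶜ z)) :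
    agr f g = density A.powerset Aᶜ.powerset P := by
  classical
  rw [density, ← expect_cube A fun X Y => if P X Y then (1 : ℝ) else 0, expect_eq_sum_div_card, agr,
    card_filter, Nat.cast_sum, card_univ]
  simp only [← h, Nat.cast_ite, Nat.cast_one, Nat.cast_zero]

end Cube

section SymFun

/-- The Boolean function computed modulo `2` by the blockwise symmetric polynomial
`∑ t a b e_a(x) e_b(y)`, where `x` are the variables in `A` and `y` the other ones. -/
def symFun {ι : Type*} [Fintype ι] [DecidableEq ι] (t : ℕ → ℕ → ZMod 2) (A : Finset ι)
    (z : ι → Bool) : Bool :=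
  decide (symEval t #(onesIn A z) #(onesIn Aᶜ z) = 1)

theorem lift_one_symFun_eq_iff {ι : Type*} [Fintype ι] [DecidableEq ι] (t : ℕ → ℕ → ZMod 2)
    (A : Finset ι) (z : ι → Bool) (q : Finset ι → ZMod 2) :
    lift 1 (symFun t A) z = ∑ T ∈ (onesIn univ z).powerset, q T ↔
      blockEval (fun S T => t #S #T + q (S ∪ T)) (onesIn A z) (onesIn Aᶜ z) = 0 := by
  have hite : ∀ u v : ZMod 2, (if u = 1 then 1 else 0) = v ↔ u + v = 0 := by decide
  have hsum : blockEval (fun S T => t #S #T + q (S ∪ T)) (onesIn A z) (onesIn Aᶜ z) =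
      symEval t #(onesIn A z) #(onesIn Aᶜ z) + ∑ T ∈ (onesIn univ z).powerset, q T := by
    rw [← onesIn_union_onesIn_compl A, sum_powerset_union (disjoint_onesIn_onesIn_compl A z),
      ← blockEval_eq_symEval (c := fun S T => t #S #T) (fun _ _ _ _ _ => rfl)
        (onesIn_subset A z) (onesIn_subset Aᶜ z)]
    simp only [blockEval, sum_add_distrib]
  rw [hsum, ← hite]
  simp only [lift, symFun, decide_eq_true_eq]
  rfl

theorem exists_gamma_symFun_le {t : ℕ → ℕ → ZMod 2} {k D : ℕ} {δ : ℝ} (hk : k < D)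
    (ht : ∀ a b, D < a + b → t a b = 0)
    (hsym : ∀ᶠ p : ℕ × ℕ in atTop, ∀ g : ℕ → ℕ → ZMod 2, (∀ a b, D ≤ a + b → g a b = t a b) →
      density (range p.1).powerset (range p.2).powerset (fun X Y => symEval g #X #Y = 0) ≤ δ) :
    ∃ N, ∀ {ι : Type u} [Fintype ι] [DecidableEq ι] (A : Finset ι), N ≤ #A → N ≤ #Aᶜ →
      gamma k 1 (symFun t A) ≤ δ := by
  obtain ⟨N, hN⟩ := exists_density_blockEval_le.{u, u} (P := (· = 0)) ht hsym
  refine ⟨N, fun A hA hA' => ?_⟩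
  obtain ⟨⟨Q, hQ, hQγ⟩, -⟩ := isGreatest_gamma k 1 (symFun t A)
  obtain ⟨q, hq, hQq⟩ := exists_polyFun_eq_sum_powerset Q
  rw [← hQγ]
  refine (agr_eq_density fun z => ?_).trans_le
    (hN A Aᶜ (fun S T => t #S #T + q (S ∪ T)) hA hA' fun S hS T hT hST => ?_)
  · rw [hQq]
    exact lift_one_symFun_eq_iff t A z q
  · have hcard : #(S ∪ T) = #S + #T :=
      card_union_of_disjoint (disjoint_compl_right.mono hS hT)
    have htop : q (S ∪ T) = 0 := hq _ (hQ.2.trans_lt (by lia))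
    exact (congrArg (t #S #T + ·) htop).trans (add_zero _)

end SymFun

section BlockEsymm

variable {ι : Type*}

/-- The elementary symmetric polynomial of degree `d` in the variables of the block `A`. -/
noncomputable def blockEsymm (R : Type*) [CommSemiring R] (A : Finset ι) (d : ℕ) :
    MvPolynomial ι R :=
  ∑ S ∈ A.powersetCard d, ∏ i ∈ S, MvPolynomial.X i

variable {R : Type*} [CommSemiring R]

theorem polyFun_blockEsymm (A : Finset ι) (d : ℕ) (z : ι → Bool) :
    polyFun (blockEsymm R A d) z = (#(onesIn A z)).choose d := by
  classical
  have hones : {S ∈ A.powersetCard d | ∀ i ∈ S, z i} = (onesIn A z).powersetCard d := by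
    ext S
    simp only [onesIn, mem_filter, mem_powersetCard, subset_iff]
    grind
  simp only [polyFun, blockEsymm, map_sum, map_prod, MvPolynomial.eval_X, prod_ite_zero,
    prod_const_one]
  rw [sum_boole, hones, card_powersetCard]

theorem degreeOf_blockEsymm_le [DecidableEq ι] (A : Finset ι) (d : ℕ) (i : ι) :
    (blockEsymm R A d).degreeOf i ≤ if i ∈ A then 1 else 0 := by
  rcases subsingleton_or_nontrivial R with _ | _
  · simp [Subsingleton.elim (blockEsymm R A d) 0]
  refine (MvPolynomial.degreeOf_sum_le _ _ _).trans (Finset.sup_le fun S hS => ?_)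
  refine (MvPolynomial.degreeOf_prod_le _ _ _).trans ?_
  simp only [MvPolynomial.degreeOf_X, sum_ite_eq]
  split_ifs with hiS hiA
  · rfl
  · exact absurd ((mem_powersetCard.1 hS).1 hiS) hiA
  · exact zero_le_one
  · rfl

theorem totalDegree_blockEsymm_le (A : Finset ι) (d : ℕ) :
    (blockEsymm R A d).totalDegree ≤ d := by
  rcases subsingleton_or_nontrivial R with _ | _
  · simp [Subsingleton.elim (blockEsymm R A d) 0]
  refine MvPolynomial.totalDegree_finsetSum_le fun S hS => ?_
  refine (MvPolynomial.totalDegree_finsetProd _ _).trans_eq ?_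
  simp only [MvPolynomial.totalDegree_X, sum_const, smul_eq_mul, mul_one, (mem_powersetCard.1 hS).2]

variable [Fintype ι] [DecidableEq ι]

theorem blockEsymm_mul_blockEsymm_compl_mem (A : Finset ι) (d k : ℕ) :
    blockEsymm (ZMod (2 ^ k)) A d * blockEsymm _ Aᶜ d ∈ multilinearPolys ι (2 * d) k := by
  refine ⟨fun i => ?_, ?_⟩
  · refine (MvPolynomial.degreeOf_mul_le _ _ _).trans <| (add_le_add
      (degreeOf_blockEsymm_le A d i) (degreeOf_blockEsymm_le Aᶜ d i)).trans ?_
    simp only [mem_compl]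
    split_ifs <;> rfl
  · rw [two_mul]
    exact (MvPolynomial.totalDegree_mul _ _).trans
      (add_le_add (totalDegree_blockEsymm_le A d) (totalDegree_blockEsymm_le Aᶜ d))

theorem density_le_gamma_two_symFun (l : ℕ) (A : Finset ι) :
    density A.powerset Aᶜ.powerset (fun X Y =>
        ((#X).choose (2 ^ l) : ZMod 2) = 0 ∨ ((#Y).choose (2 ^ l) : ZMod 2) = 0) ≤
      gamma (2 * 2 ^ l) 2 (symFun (crossTop (2 ^ l)) A) := by
  refine le_trans ?_ ((isGreatest_gamma (2 * 2 ^ l) 2 (symFun (crossTop (2 ^ l)) A)).2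
    ⟨_, blockEsymm_mul_blockEsymm_compl_mem A (2 ^ l) 2, rfl⟩)
  refine (density_mono fun X _ Y _ => ite_symEval_crossTop_eq_choose_mul_choose).trans_eq
    (agr_eq_density fun z => ?_).symm
  rw [polyFun, map_mul, ← polyFun, ← polyFun, polyFun_blockEsymm, polyFun_blockEsymm]
  simp only [lift, symFun, decide_eq_true_eq]
  rfl

end BlockEsymm

section Halves

theorem exists_le_gamma_two_symFun_crossTop (l : ℕ) {ε : ℝ} (hε : 0 < ε) :
    ∃ N, ∀ {ι : Type u} [Fintype ι] [DecidableEq ι] (A : Finset ι), N ≤ #A → N ≤ #Aᶜ →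
      3 / 4 - ε ≤ gamma (2 * 2 ^ l) 2 (symFun (crossTop (2 ^ l)) A) := by
  obtain ⟨N, hN⟩ := eventually_atTop_prod_self.1 (eventually_le_density_choose_even l hε)
  refine ⟨N, fun A hA hA' => (hN _ _ hA hA').trans ?_⟩
  exact (density_powerset_card_congr (card_range #A) (card_range #Aᶜ) fun x y =>
    (x.choose (2 ^ l) : ZMod 2) = 0 ∨ (y.choose (2 ^ l) : ZMod 2) = 0).trans_le
      (density_le_gamma_two_symFun l A)

theorem exists_gamma_one_symFun_crossTop_le (l : ℕ) {ε : ℝ} (hε : 0 < ε) :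
    ∃ N, ∀ {ι : Type u} [Fintype ι] [DecidableEq ι] (A : Finset ι), N ≤ #A → N ≤ #Aᶜ →
      gamma (3 * 2 ^ l - 1) 1 (symFun (crossTop (2 ^ l)) A) ≤ 5 / 8 + ε :=
  exists_gamma_symFun_le (Nat.sub_one_lt (mul_pos three_pos (Nat.two_pow_pos l)).ne')
    (fun _ _ => crossTop_of_lt) (eventually_density_symEval_le l hε)

/-- The function computed modulo `2` by `e_d(x) e_{2d}(y) + e_{2d}(x) e_d(y)`, where `x` and `y` are
the two halves of the `2n` variables. -/
def halvesFun (d n : ℕ) : (Fin (2 * n) → Bool) → Bool :=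
  symFun (crossTop d) {i | i.val < n}

theorem eventually_le_gamma_two_and_gamma_one_le (l : ℕ) {ε : ℝ} (hε : 0 < ε) :
    ∀ᶠ n in atTop, 3 / 4 - ε ≤ gamma (2 * 2 ^ l) 2 (halvesFun (2 ^ l) n) ∧
      gamma (3 * 2 ^ l - 1) 1 (halvesFun (2 ^ l) n) ≤ 5 / 8 + ε := by
  obtain ⟨N₂, h₂⟩ := exists_le_gamma_two_symFun_crossTop l hε
  obtain ⟨N₁, h₁⟩ := exists_gamma_one_symFun_crossTop_le l hε
  filter_upwards [eventually_ge_atTop N₁, eventually_ge_atTop N₂] with n hn₁ hn₂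
  have hcard : #({i | i.val < n} : Finset (Fin (2 * n))) = n := by
    rw [Fin.card_filter_val_lt, min_eq_right (by lia)]
  have hcompl : #({i | i.val < n} : Finset (Fin (2 * n)))ᶜ = n := by
    rw [card_compl, Fintype.card_fin, hcard, two_mul, Nat.add_sub_cancel]
  exact ⟨h₂ _ (hn₂.trans_eq hcard.symm) (hn₂.trans_eq hcompl.symm),
    h₁ _ (hn₁.trans_eq hcard.symm) (hn₁.trans_eq hcompl.symm)⟩

theorem exists_tendsto_zero_of_eventually_le {u : ℕ → ℝ} (h : ∀ ε > 0, ∀ᶠ n in atTop, u n ≤ ε) :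
    ∃ ε : ℕ → ℝ, Tendsto ε atTop (𝓝 0) ∧ ∀ n, u n ≤ ε n := by
  refine ⟨fun n => max 0 (u n), ?_, fun n => le_max_right _ _⟩
  refine tendsto_order.2 ⟨fun a ha => .of_forall fun n => ha.trans_le (le_max_left _ _), ?_⟩
  intro a ha
  filter_upwards [h (a / 2) (half_pos ha)] with n hn
  exact (max_le (half_pos ha).le hn).trans_lt (half_lt_self ha)

theorem exists_error_gamma_halvesFun (l : ℕ) : ∃ ε : ℕ → ℝ, Tendsto ε atTop (𝓝 0) ∧
    ∀ n, 3 / 4 - ε n ≤ gamma (2 * 2 ^ l) 2 (halvesFun (2 ^ l) n) ∧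
      gamma (3 * 2 ^ l - 1) 1 (halvesFun (2 ^ l) n) ≤ 5 / 8 + ε n := by
  obtain ⟨ε, hε, hle⟩ := exists_tendsto_zero_of_eventually_le
    (u := fun n => max (3 / 4 - gamma (2 * 2 ^ l) 2 (halvesFun (2 ^ l) n))
      (gamma (3 * 2 ^ l - 1) 1 (halvesFun (2 ^ l) n) - 5 / 8)) fun ε hε =>
    (eventually_le_gamma_two_and_gamma_one_le l hε).mono fun n hn =>
      max_le (sub_le_comm.1 hn.1) (sub_le_iff_le_add'.2 hn.2)
  exact ⟨ε, hε, fun n => ⟨sub_le_comm.1 ((le_max_left _ _).trans (hle n)),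
    sub_le_iff_le_add'.1 ((le_max_right _ _).trans (hle n))⟩⟩

theorem eventually_gamma_one_lt_gamma_two (l : ℕ) : ∀ᶠ n in atTop,
    gamma (3 * 2 ^ l - 1) 1 (halvesFun (2 ^ l) n) < gamma (2 * 2 ^ l) 2 (halvesFun (2 ^ l) n) := by
  filter_upwards [eventually_le_gamma_two_and_gamma_one_le l (ε := 1 / 32) (by norm_num)]
    with n ⟨h₂, h₁⟩
  linarith

end Halves

end BoolApprox

theorem mainTheorem3 :
    (∀ d : ℕ, (∃ l : ℕ, d = 2 ^ l) →
      ∃ ε : ℕ → ℝ, Tendsto ε atTop (𝓝 0) ∧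
        ∀ᶠ n : ℕ in atTop, ∃ F : (Fin (2 * n) → Bool) → Bool,
          3 / 4 - ε n ≤ BoolApprox.gamma (2 * d) 2 F ∧
          BoolApprox.gamma (3 * d - 1) 1 F ≤ 5 / 8 + ε n ∧
          BoolApprox.gamma (3 * d - 1) 1 F < BoolApprox.gamma (2 * d) 2 F) ∧
    (∀ᶠ n : ℕ in atTop, ∃ F : (Fin (2 * n) → Bool) → Bool,
      BoolApprox.gamma 2 1 F < BoolApprox.gamma 2 2 F) := by
  constructor
  · rintro _ ⟨l, rfl⟩
    obtain ⟨ε, hε, hγ⟩ := BoolApprox.exists_error_gamma_halvesFun l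
    refine ⟨ε, hε, ?_⟩
    filter_upwards [BoolApprox.eventually_gamma_one_lt_gamma_two l] with n hlt
    exact ⟨BoolApprox.halvesFun (2 ^ l) n, (hγ n).1, (hγ n).2, hlt⟩
  · filter_upwards [BoolApprox.eventually_gamma_one_lt_gamma_two 0] with n hlt
    exact ⟨BoolApprox.halvesFun 1 n, hlt⟩
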